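/- A (bivariate) copula is a function $C:[0,1]^2\to\mathbb R$ with $C(u,0)=C(0,v)=0$, $C(u,1)=u$, $C(1,v)=v$ for all $u,v\in[0,1]$ and $C(u_2,v_2)-C(u_2,v_1)-C(u_1,v_2)+C(u_1,v_1)\ge 0$ whenever $0\le u_1\le u_2\le 1$ and $0\le v_1\le v_2\le 1$. Its transpose is $C^t(u,v)=C(v,u)$, and $C$ is symmetric if $C=C^t$. Put $$\mu_\infty(C)=\max_{u,v\in[0,1]}|C(u,v)-C(v,u)|,\qquad \tau(C)=4\int_{[0,1]^2}C(u,v)\,dC(u,v)-1,$$ where $dC$ denotes integration with respect to the Borel probability measure on $[0,1]^2$ that gives mass $C(u,v)$ to $[0,u]\times[0,v]$ for all $u,v$. ($\tau$ is Kendall's tau.) **Theorem 6.2.** The largest possible value of $\mu_\infty$ on the set of all copulas is $\frac13$. If $C$ is any copula and $m=\mu_\infty(C)$, then $$\tau(C)\in[4m^2-1,\;1-8m^2].$$ Conversely, for every $m\in[0,\frac13]$, every value in $[4m^2-1,1-8m^2]$ is attained by $\tau$ at some copula $C$ with $\mu_\infty(C)=m$. In particular, the set of values of $\tau(C)$ over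 all symmetric copulas $C$ is $[-1,1]$, and the set of values of $\tau(C)$ over all copulas $C$ with the maximal asymmetry $\mu_\infty(C)=\frac13$ is $[-\frac59,\frac19]$. -/

import Mathlib

open MeasureTheory Set Filter Topology unitInterval

/-- A (bivariate) copula: a function on the unit square that is grounded, has uniform margins and is
2-increasing (the volume of every rectangle is nonnegative). -/
@[ext]
structure Copula where
  toFun : I → I → ℝ
  zero_left : ∀ v, toFun 0 v = 0
  zero_right : ∀ u, toFun u 0 = 0
  one_left : ∀ v : I, toFun 1 v = v
  one_right : ∀ u : I, toFun u 1 = u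
  two_increasing : ∀ u₁ u₂ v₁ v₂ : I, u₁ ≤ u₂ → v₁ ≤ v₂ →
    0 ≤ toFun u₂ v₂ - toFun u₂ v₁ - toFun u₁ v₂ + toFun u₁ v₁

namespace Copula

instance : CoeFun Copula (fun _ => I → I → ℝ) := ⟨Copula.toFun⟩

/-- The transpose `Cᵗ(u, v) = C(v, u)`. -/
def transpose (C : Copula) : Copula where
  toFun u v := C v u
  zero_left := C.zero_right
  zero_right := C.zero_left
  one_left := C.one_right
  one_right := C.one_left
  two_increasing u₁ u₂ v₁ v₂ hu hv := by
    have h := C.two_increasing v₁ v₂ u₁ u₂ hv hu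
    linarith

/-- A copula is symmetric (exchangeable) if it equals its transpose. -/
def IsSymmetric (C : Copula) : Prop := C.transpose = C

/-- The uniform distance `d_∞(C, D) = max |C(u,v) - D(u,v)|` over the unit square. -/
noncomputable def dInf (C D : Copula) : ℝ := ⨆ p : I × I, |C p.1 p.2 - D p.1 p.2|

/-- The measure of asymmetry `μ_∞(C) = d_∞(C, Cᵗ)`. -/
noncomputable def muInf (C : Copula) : ℝ := dInf C C.transpose

/-! The probability measure on the unit square whose distribution function is a given copula. -/

theorem mono_left (C : Copula) {u u' : I} (v : I) (h : u ≤ u') : C u v ≤ C u' v := by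
  have := C.two_increasing u u' 0 v h unitInterval.nonneg'
  rw [C.zero_right, C.zero_right] at this
  linarith

theorem mono_right (C : Copula) (u : I) {v v' : I} (h : v ≤ v') : C u v ≤ C u v' :=
  C.transpose.mono_left u h

theorem lip_left (C : Copula) {u u' : I} (v : I) (h : u ≤ u') :
    C u' v - C u v ≤ (u' : ℝ) - u := by
  have := C.two_increasing u u' v 1 h unitInterval.le_one'
  rw [C.one_right, C.one_right] at this
  linarith

theorem lip_right (C : Copula) (u : I) {v v' : I} (h : v ≤ v') :
    C u v' - C u v ≤ (v' : ℝ) - v :=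
  C.transpose.lip_left u h

/-- The grid point `k / (n + 1)` (truncated at `1`). -/
noncomputable def gridPt (n k : ℕ) : I := projIcc 0 1 zero_le_one ((k : ℝ) / (n + 1))

theorem gridPt_mono (n : ℕ) : Monotone (gridPt n) := by
  intro i j h
  apply monotone_projIcc
  gcongr

theorem coe_gridPt {n k : ℕ} (h : k ≤ n + 1) : (gridPt n k : ℝ) = (k : ℝ) / (n + 1) := by
  have h' : (k : ℝ) ≤ n + 1 := by exact_mod_cast h
  rw [gridPt, projIcc_of_mem zero_le_one ⟨by positivity, (div_le_one (by positivity)).2 h'⟩]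

/-- The index of the last grid point below `u`. -/
noncomputable def gridIdx (n : ℕ) (u : I) : ℕ := ⌊((n : ℝ) + 1) * u⌋₊

theorem gridIdx_le (n : ℕ) (u : I) : gridIdx n u ≤ n + 1 := by
  have h : ((n : ℝ) + 1) * u ≤ ((n + 1 : ℕ) : ℝ) := by
    push_cast
    exact mul_le_of_le_one_right (by positivity) u.2.2
  exact Nat.floor_le_of_le h

theorem gridPt_le_iff {n i : ℕ} (hi : i < n + 1) (u : I) :
    gridPt n (i + 1) ≤ u ↔ i < gridIdx n u := by
  have h0 : (0 : ℝ) < n + 1 := by positivity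
  have hu : (0 : ℝ) ≤ (n + 1) * u := mul_nonneg h0.le u.2.1
  rw [← Subtype.coe_le_coe, coe_gridPt hi, div_le_iff₀ h0, mul_comm, gridIdx, ← Nat.succ_le_iff,
    Nat.le_floor_iff hu]

theorem gridPt_gridIdx_le (n : ℕ) (u : I) : gridPt n (gridIdx n u) ≤ u := by
  have h0 : (0 : ℝ) < n + 1 := by positivity
  rw [← Subtype.coe_le_coe, coe_gridPt (gridIdx_le n u), div_le_iff₀ h0, mul_comm]
  exact Nat.floor_le (mul_nonneg h0.le u.2.1)

theorem sub_gridPt_le (n : ℕ) (u : I) : (u : ℝ) - gridPt n (gridIdx n u) ≤ 1 / (n + 1) := by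
  have h0 : (0 : ℝ) < n + 1 := by positivity
  have h := (Nat.lt_floor_add_one (((n : ℝ) + 1) * u)).le
  rw [coe_gridPt (gridIdx_le n u), sub_le_iff_le_add, ← add_div, le_div_iff₀ h0, gridIdx]
  linarith

/-- The `C`-volume of a grid cell. -/
noncomputable def cellVol (C : Copula) (n i j : ℕ) : ℝ :=
  C (gridPt n (i + 1)) (gridPt n (j + 1)) - C (gridPt n (i + 1)) (gridPt n j)
    - C (gridPt n i) (gridPt n (j + 1)) + C (gridPt n i) (gridPt n j)

theorem cellVol_nonneg (C : Copula) (n i j : ℕ) : 0 ≤ C.cellVol n i j :=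
  C.two_increasing _ _ _ _ (gridPt_mono n (Nat.le_succ i)) (gridPt_mono n (Nat.le_succ j))

theorem gridPt_zero (n : ℕ) : gridPt n 0 = 0 := by
  apply Subtype.ext
  rw [coe_gridPt (Nat.zero_le _)]
  simp

theorem sum_cellVol (C : Copula) (n s t : ℕ) :
    ∑ i ∈ Finset.range s, ∑ j ∈ Finset.range t, C.cellVol n i j = C (gridPt n s) (gridPt n t) := by
  have h1 : ∀ i, ∑ j ∈ Finset.range t, C.cellVol n i j
      = C (gridPt n (i + 1)) (gridPt n t) - C (gridPt n i) (gridPt n t) := by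
    intro i
    have := Finset.sum_range_sub
      (fun j => C (gridPt n (i + 1)) (gridPt n j) - C (gridPt n i) (gridPt n j)) t
    simp only [gridPt_zero, C.zero_right, sub_zero] at this
    rw [← this]
    refine Finset.sum_congr rfl fun j _ => ?_
    simp only [cellVol]
    ring
  simp only [h1]
  have := Finset.sum_range_sub (fun i => C (gridPt n i) (gridPt n t)) s
  simpa only [gridPt_zero, C.zero_left, sub_zero] using this

/-- Discretization of `C` on a grid. -/
noncomputable def gridMeasure (C : Copula) (n : ℕ) : Measure (I × I) :=
  ∑ i ∈ Finset.range (n + 1), ∑ j ∈ Finset.range (n + 1),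
    ENNReal.ofReal (C.cellVol n i j) • Measure.dirac (gridPt n (i + 1), gridPt n (j + 1))

theorem gridMeasure_Iic (C : Copula) (n : ℕ) (u v : I) :
    C.gridMeasure n (Iic (u, v))
      = ENNReal.ofReal (C (gridPt n (gridIdx n u)) (gridPt n (gridIdx n v))) := by
  rw [← C.sum_cellVol, ENNReal.ofReal_sum_of_nonneg
    (fun i _ => Finset.sum_nonneg fun j _ => C.cellVol_nonneg n i j)]
  simp only [gridMeasure, Measure.coe_finsetSum, Finset.sum_apply, Measure.smul_apply,
    smul_eq_mul]
  have key : ∀ i ∈ Finset.range (n + 1), ∀ j ∈ Finset.range (n + 1),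
      ENNReal.ofReal (C.cellVol n i j)
        * Measure.dirac (gridPt n (i + 1), gridPt n (j + 1)) (Iic (u, v))
      = if i < gridIdx n u then (if j < gridIdx n v then ENNReal.ofReal (C.cellVol n i j) else 0)
        else 0 := by
    intro i hi j hj
    rw [Measure.dirac_apply' _ measurableSet_Iic]
    simp only [indicator_apply, mem_Iic, Prod.mk_le_mk, gridPt_le_iff (Finset.mem_range.1 hi),
      gridPt_le_iff (Finset.mem_range.1 hj)]
    by_cases h1 : i < gridIdx n u <;> by_cases h2 : j < gridIdx n v <;> simp [h1, h2]
  rw [Finset.sum_congr rfl fun i hi => Finset.sum_congr rfl (key i hi)]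
  have filt : ∀ (w : I) (f : ℕ → ENNReal),
      ∑ i ∈ Finset.range (n + 1), (if i < gridIdx n w then f i else 0)
        = ∑ i ∈ Finset.range (gridIdx n w), f i := by
    intro w f
    rw [← Finset.sum_filter]
    refine Finset.sum_congr ?_ fun _ _ => rfl
    ext i
    have := gridIdx_le n w
    simp only [Finset.mem_filter, Finset.mem_range]
    omega
  rw [← filt u]
  refine Finset.sum_congr rfl fun i _ => ?_
  split_ifs
  · rw [filt v, ENNReal.ofReal_sum_of_nonneg fun j _ => C.cellVol_nonneg n i j]
  · simp

theorem tendsto_gridPt (u : I) : Tendsto (fun n => (gridPt n (gridIdx n u) : ℝ)) atTop (𝓝 u) := by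
  have h : Tendsto (fun n : ℕ => (u : ℝ) - 1 / ((n : ℝ) + 1)) atTop (𝓝 u) := by
    simpa using tendsto_one_div_add_atTop_nhds_zero_nat.const_sub (u : ℝ)
  refine tendsto_of_tendsto_of_tendsto_of_le_of_le h tendsto_const_nhds (fun n => ?_) fun n => ?_
  · have := sub_gridPt_le n u
    simp only
    linarith
  · exact gridPt_gridIdx_le n u

theorem tendsto_gridMeasure_Iic (C : Copula) (u v : I) :
    Tendsto (fun n => C.gridMeasure n (Iic (u, v))) atTop (𝓝 (ENNReal.ofReal (C u v))) := by
  simp only [gridMeasure_Iic]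
  refine ENNReal.tendsto_ofReal ?_
  have hlow : Tendsto (fun n => C u v - ((u : ℝ) - gridPt n (gridIdx n u))
      - ((v : ℝ) - gridPt n (gridIdx n v))) atTop (𝓝 (C u v)) := by
    simpa using ((tendsto_gridPt u).const_sub (u : ℝ)).const_sub (C u v) |>.sub
      ((tendsto_gridPt v).const_sub (v : ℝ))
  refine tendsto_of_tendsto_of_tendsto_of_le_of_le hlow tendsto_const_nhds (fun n => ?_) fun n => ?_
  · have h1 := C.lip_left v (gridPt_gridIdx_le n u)
    have h2 := C.lip_right (gridPt n (gridIdx n u)) (gridPt_gridIdx_le n v)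
    simp only
    linarith
  · exact (C.mono_left _ (gridPt_gridIdx_le n u)).trans (C.mono_right _ (gridPt_gridIdx_le n v))

theorem gridMeasure_univ (C : Copula) (n : ℕ) : C.gridMeasure n univ = 1 := by
  have h : (univ : Set (I × I)) = Iic ((1 : I), (1 : I)) := by
    ext p
    simp only [mem_univ, mem_Iic, true_iff]
    exact ⟨unitInterval.le_one', unitInterval.le_one'⟩
  have hi : gridIdx n 1 = n + 1 := by
    have : ((n : ℝ) + 1) * ((1 : I) : ℝ) = ((n + 1 : ℕ) : ℝ) := by push_cast; simp
    rw [gridIdx, this, Nat.floor_natCast]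
  have hg : gridPt n (n + 1) = 1 := by
    apply Subtype.ext
    rw [coe_gridPt le_rfl]
    push_cast
    exact div_self (by positivity)
  rw [h, gridMeasure_Iic, hi, hg, C.one_left]
  simp

theorem exists_measure (C : Copula) :
    ∃ μ : Measure (I × I), IsProbabilityMeasure μ ∧
      ∀ u v : I, μ (Iic (u, v)) = ENNReal.ofReal (C u v) := by
  let P : ℕ → ProbabilityMeasure (I × I) := fun n => ⟨C.gridMeasure n, ⟨C.gridMeasure_univ n⟩⟩
  let L : Ultrafilter ℕ := hyperfilter ℕ
  have hL : (L : Filter ℕ) ≤ atTop := by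
    rw [← Nat.cofinite_eq_atTop]
    exact hyperfilter_le_cofinite
  obtain ⟨μ, -, hμ⟩ := isCompact_univ.ultrafilter_le_nhds (L.map P) (by simp)
  have hlim : Tendsto P L (𝓝 μ) := hμ
  have hIic : ∀ u v : I, Tendsto (fun n => (P n : Measure (I × I)) (Iic (u, v))) L
      (𝓝 (ENNReal.ofReal (C u v))) := fun u v => (C.tendsto_gridMeasure_Iic u v).mono_left hL
  refine ⟨μ, inferInstance, fun u v => le_antisymm ?_ ?_⟩
  · have hε : ∀ ε : ℝ, 0 < ε →
        (μ : Measure (I × I)) (Iic (u, v)) ≤ ENNReal.ofReal (C u v + (ε + ε)) := by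
      intro ε hε
      have hp : ∀ w : I, w ≤ projIcc 0 1 zero_le_one ((w : ℝ) + ε) := fun w => by
        conv_lhs => rw [← projIcc_val (zero_le_one (α := ℝ)) w]
        exact monotone_projIcc _ (by linarith)
      have hq : ∀ w : I, (projIcc 0 1 zero_le_one ((w : ℝ) + ε) : ℝ) ≤ w + ε := fun w => by
        rw [coe_projIcc]
        exact max_le (add_nonneg w.2.1 hε.le) (min_le_right _ _)
      set u' : I := projIcc 0 1 zero_le_one ((u : ℝ) + ε) with hu'
      set v' : I := projIcc 0 1 zero_le_one ((v : ℝ) + ε) with hv'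
      let G : Set (I × I) := {p | (p.1 : ℝ) < u + ε ∧ (p.2 : ℝ) < v + ε}
      have hG : IsOpen G :=
        (isOpen_lt (f := fun p : I × I => (p.1 : ℝ)) (g := fun _ => (u : ℝ) + ε)
          (by fun_prop) (by fun_prop)).inter
        (isOpen_lt (f := fun p : I × I => (p.2 : ℝ)) (g := fun _ => (v : ℝ) + ε)
          (by fun_prop) (by fun_prop))
      have hle : ∀ (w x : I), (x : ℝ) < w + ε → x ≤ projIcc 0 1 zero_le_one ((w : ℝ) + ε) := by
        intro w x hx
        conv_lhs => rw [← projIcc_val (zero_le_one (α := ℝ)) x]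
        exact monotone_projIcc _ hx.le
      calc (μ : Measure (I × I)) (Iic (u, v)) ≤ (μ : Measure (I × I)) G := by
            refine measure_mono fun p hp => ⟨?_, ?_⟩
            · have : (p.1 : ℝ) ≤ u := hp.1
              linarith
            · have : (p.2 : ℝ) ≤ v := hp.2
              linarith
        _ ≤ (L : Filter ℕ).liminf fun n => (P n : Measure (I × I)) G :=
            ProbabilityMeasure.le_liminf_measure_open_of_tendsto hlim hG
        _ ≤ (L : Filter ℕ).liminf fun n => (P n : Measure (I × I)) (Iic (u', v')) := by
            refine liminf_le_liminf (Eventually.of_forall fun n => measure_mono fun p hp => ?_)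
            exact ⟨hle u p.1 hp.1, hle v p.2 hp.2⟩
        _ = ENNReal.ofReal (C u' v') := (hIic u' v').liminf_eq
        _ ≤ ENNReal.ofReal (C u v + (ε + ε)) := by
            refine ENNReal.ofReal_le_ofReal ?_
            have h1 := C.lip_left v (hp u)
            have h2 := C.lip_right u' (hp v)
            have h3 := hq u
            have h4 := hq v
            linarith
    have ht : Tendsto (fun ε : ℝ => ENNReal.ofReal (C u v + (ε + ε))) (𝓝[>] 0)
        (𝓝 (ENNReal.ofReal (C u v))) := by
      have hc : Continuous fun ε : ℝ => ENNReal.ofReal (C u v + (ε + ε)) :=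
        ENNReal.continuous_ofReal.comp (by fun_prop)
      have := hc.tendsto 0
      simp only [add_zero] at this
      exact this.mono_left nhdsWithin_le_nhds
    exact ge_of_tendsto ht (eventually_mem_nhdsWithin.mono fun ε hpos => hε ε hpos)
  · have := ProbabilityMeasure.limsup_measure_closed_le_of_tendsto hlim
      (isClosed_Iic (a := ((u, v) : I × I)))
    rwa [(hIic u v).limsup_eq] at this

/-- The probability measure `dC` on the unit square with distribution function `C`, that is, the
measure giving mass `C(u, v)` to `[0, u] × [0, v]`; it is unique by `measure_unique`. -/
noncomputable def measure (C : Copula) : Measure (I × I) := Classical.choose C.exists_measure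

instance (C : Copula) : IsProbabilityMeasure C.measure :=
  (Classical.choose_spec C.exists_measure).1

theorem measure_Iic (C : Copula) (u v : I) :
    C.measure (Iic (u, v)) = ENNReal.ofReal (C u v) :=
  (Classical.choose_spec C.exists_measure).2 u v

theorem measure_unique (C : Copula) (μ : Measure (I × I))
    (h : ∀ u v : I, μ (Iic (u, v)) = ENNReal.ofReal (C u v)) : μ = C.measure := by
  have huniv : (univ : Set (I × I)) = Iic ((1 : I), (1 : I)) := by
    ext p
    simp only [mem_univ, mem_Iic, true_iff]
    exact ⟨unitInterval.le_one', unitInterval.le_one'⟩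
  have hgen : MeasurableSpace.generateFrom (range (Iic : I → Set I)) =
      (inferInstance : MeasurableSpace I) := by
    rw [← borel_eq_generateFrom_Iic I]
    exact (BorelSpace.measurable_eq (α := I)).symm
  have hspan : IsCountablySpanning (range (Iic : I → Set I)) :=
    ⟨fun _ => Iic 1, fun _ => ⟨1, rfl⟩, by
      rw [iUnion_const]
      exact eq_univ_of_forall fun x => unitInterval.le_one'⟩
  refine (ext_of_generate_finite _ (generateFrom_eq_prod hgen hgen hspan hspan).symm
    (isPiSystem_Iic.prod isPiSystem_Iic) ?_ ?_).symm
  · rintro _ ⟨_, ⟨u, rfl⟩, _, ⟨v, rfl⟩, rfl⟩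
    simp only [Iic_prod_Iic]
    rw [h, measure_Iic]
  · rw [huniv, h, measure_Iic]

/-- The concordance function `Q(C₁, C₂) = 4 ∫ C₂ dC₁ - 1`. -/
noncomputable def concordance (C₁ C₂ : Copula) : ℝ :=
  4 * ∫ p : I × I, C₂ p.1 p.2 ∂C₁.measure - 1

/-- Kendall's tau `τ(C) = Q(C, C)`. -/
noncomputable def kendallTau (C : Copula) : ℝ := concordance C C

end Copula

/-!
Let `(X, Y)` and `(X', Y')` be independent with distribution `C`, so that `∫ C dC` is the
probability that `X ≤ X'` and `Y ≤ Y'`. Both bounds come from comparing this event with a single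
pair of rectangles. If `(X, Y)` lies to the lower left of `(a, b)` and `(X', Y')` to its upper
right, the pair is concordant, which gives `∫ C dC ≥ C(a, b) (1 - a - b + C(a, b))`
(`mul_le_integral_self`). If `(X, Y)` lies to the upper left of `(b, a)` and `(X', Y')` to its
lower right, the pair is discordant, which gives `∫ C dC ≤ 1 / 2 - (a - C(b, a)) (b - C(b, a))`
(`integral_self_le`). When `k = C(a, b) - C(b, a) ≥ 0`, each factor in the first product is at
least `k`; in the second product both factors are at least `k` and one of them is at least `2 k`.
At a point where the asymmetry is `k = μ_∞(C)` this is the claimed range of `τ`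
(`kendallTau_mem`). Moreover `k ≤ min a b`, `k ≤ |a - b|` and `k ≤ 1 - max a b`, and adding these
gives `3 k ≤ 1`.

Equality holds for explicit shuffles. Let `V` be the copula of the interval exchange that swaps
two adjacent blocks of lengths `p` and `q` (`blockSwap`); pairs are discordant exactly when their
first coordinates lie in the two different blocks, so `τ(V) = 1 - 4 p q`. The choice `p = 2 m`,
`q = m` gives the upper bound. The choice `p = q = m`, followed by the reflection `x ↦ 1 - x`,
which changes the sign of `τ` (`kendallTau_reflect`), gives the lower bound. With suitably placed
blocks both copulas have their largest asymmetry `m` at the same point and with the same sign, so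
the segment between them consists of copulas of asymmetry `m`. As `τ` is continuous on it
(`continuous_kendallTau_mix`), all intermediate values occur.
-/

namespace Copula

/-! ### Pointwise bounds and continuity -/

theorem nonneg (C : Copula) (u v : I) : 0 ≤ C u v := by
  have := C.mono_right u (unitInterval.nonneg' (t := v))
  rwa [C.zero_right] at this

theorem le_left (C : Copula) (u v : I) : C u v ≤ u := by
  have := C.mono_right u (unitInterval.le_one' (t := v))
  rwa [C.one_right] at this

theorem le_right (C : Copula) (u v : I) : C u v ≤ v := C.transpose.le_left v u

theorem add_sub_one_le (C : Copula) (u v : I) : (u : ℝ) + v - 1 ≤ C u v := by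
  have := C.lip_right u (unitInterval.le_one' (t := v))
  rw [C.one_right] at this
  simp only [Icc.coe_one] at this
  linarith

theorem sub_le_abs_add_abs (C : Copula) (u v u' v' : I) :
    C u' v' - C u v ≤ |(u' : ℝ) - u| + |(v' : ℝ) - v| := by
  have h1 : C u' v' - C u v' ≤ |(u' : ℝ) - u| := by
    rcases le_total u u' with h | h
    · exact (C.lip_left v' h).trans (le_abs_self _)
    · exact (sub_nonpos.2 (C.mono_left v' h)).trans (abs_nonneg _)
  have h2 : C u v' - C u v ≤ |(v' : ℝ) - v| := by
    rcases le_total v v' with h | h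
    · exact (C.lip_right u h).trans (le_abs_self _)
    · exact (sub_nonpos.2 (C.mono_right u h)).trans (abs_nonneg _)
  linarith

theorem continuous (C : Copula) : Continuous fun p : I × I => C p.1 p.2 := by
  refine (LipschitzWith.of_le_add_mul (K := 2) fun p q => ?_).continuous
  have h := C.sub_le_abs_add_abs q.1 q.2 p.1 p.2
  have h1 : |(p.1 : ℝ) - q.1| ≤ dist p q := le_max_left (dist p.1 q.1) (dist p.2 q.2)
  have h2 : |(p.2 : ℝ) - q.2| ≤ dist p q := le_max_right (dist p.1 q.1) (dist p.2 q.2)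
  simp only [NNReal.coe_ofNat]
  linarith

theorem integrable_of_continuous {μ : Measure (I × I)} [IsFiniteMeasure μ]
    {f : I × I → ℝ} (hf : Continuous f) : Integrable f μ :=
  hf.integrable_of_hasCompactSupport (HasCompactSupport.of_compactSpace f)

theorem integrable (C : Copula) (μ : Measure (I × I)) [IsFiniteMeasure μ] :
    Integrable (fun p : I × I => C p.1 p.2) μ :=
  integrable_of_continuous C.continuous

/-! ### Margins and masses of rectangles -/

theorem measureReal_Iic (C : Copula) (u v : I) : C.measure.real (Iic (u, v)) = C u v := by
  rw [measureReal_def, measure_Iic, ENNReal.toReal_ofReal (C.nonneg u v)]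

theorem map_snd_measure (C : Copula) : C.measure.map Prod.snd = volume := by
  refine Measure.ext_of_Iic _ _ fun v => ?_
  rw [Measure.map_apply measurable_snd measurableSet_Iic, unitInterval.volume_Iic,
    show Prod.snd ⁻¹' Iic v = Iic ((1 : I), v) by ext p; simp [Prod.le_def, unitInterval.le_one'],
    measure_Iic, C.one_left]

theorem map_fst_measure (C : Copula) : C.measure.map Prod.fst = volume := by
  refine Measure.ext_of_Iic _ _ fun u => ?_
  rw [Measure.map_apply measurable_fst measurableSet_Iic, unitInterval.volume_Iic,
    show Prod.fst ⁻¹' Iic u = Iic (u, (1 : I)) by ext p; simp [Prod.le_def, unitInterval.le_one'],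
    measure_Iic, C.one_right]

theorem integral_snd (C : Copula) : ∫ p, (p.2 : ℝ) ∂C.measure = 1 / 2 := by
  have h : ∫ v : I, (v : ℝ) = 1 / 2 := by
    have := integral_subtype_comap (μ := volume) (s := Icc (0 : ℝ) 1) measurableSet_Icc
      (fun x : ℝ => x)
    rw [integral_Icc_eq_integral_Ioc, ← intervalIntegral.integral_of_le zero_le_one,
      integral_id] at this
    norm_num at this
    norm_num
    exact this
  rw [← h, ← C.map_snd_measure, integral_map measurable_snd.aemeasurable]
  exact measurable_subtype_coe.aestronglyMeasurable

theorem measureReal_Iic_prod_Ioi (C : Copula) (u v : I) :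
    C.measure.real (Iic u ×ˢ Ioi v) = u - C u v := by
  have : Iic u ×ˢ Ioi v = Iic (u, (1 : I)) \ Iic (u, v) := by
    ext p
    simp only [mem_prod, mem_Iic, mem_Ioi, Set.mem_sdiff, Prod.le_def, unitInterval.le_one',
      and_true]
    rw [← not_le]; tauto
  rw [this, measureReal_sdiff (Iic_subset_Iic.2 (Prod.mk_le_mk.2 ⟨le_rfl, unitInterval.le_one'⟩))
    measurableSet_Iic,
    measureReal_Iic, measureReal_Iic, C.one_right]

theorem measureReal_Ioi_prod_Ioi (C : Copula) (u v : I) :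
    C.measure.real (Ioi u ×ˢ Ioi v) = 1 - u - v + C u v := by
  have h : Ioi u ×ˢ Ioi v = (Iic (1 : I) ×ˢ Ioi v) \ (Iic u ×ˢ Ioi v) := by
    ext p
    simp only [mem_prod, mem_Iic, mem_Ioi, Set.mem_sdiff, unitInterval.le_one', true_and]
    rw [← not_le (a := p.1)]; tauto
  rw [h, measureReal_sdiff
    (prod_mono_left (Iic_subset_Iic.2 unitInterval.le_one'))
      (measurableSet_Iic.prod measurableSet_Ioi), measureReal_Iic_prod_Ioi,
    measureReal_Iic_prod_Ioi, C.one_left, Icc.coe_one]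
  ring

/-- If a nonnegative continuous function is at least `c` on `S`, its integral is at least
`c μ(S)`. -/
theorem mul_measureReal_le_integral (C : Copula) {f : I × I → ℝ} (hf : Continuous f)
    (h0 : ∀ p, 0 ≤ f p) {S : Set (I × I)} (hS : MeasurableSet S) {c : ℝ} (hc : ∀ p ∈ S, c ≤ f p) :
    c * C.measure.real S ≤ ∫ p, f p ∂C.measure := by
  calc c * C.measure.real S = ∫ p, S.indicator (fun _ => c) p ∂C.measure := by
        rw [integral_indicator_const _ hS, smul_eq_mul, mul_comm]
    _ ≤ ∫ p, f p ∂C.measure := by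
        refine integral_mono ((integrable_const c).indicator hS)
          (integrable_of_continuous hf) fun p => ?_
        by_cases hp : p ∈ S
        · simpa [hp] using hc p hp
        · simpa [hp] using h0 p

/-! ### Bounds for Kendall's tau at a point of asymmetry -/

/-- The lower bound behind `4 m² - 1`: on the open rectangle above and to the right of `(u, v)` the
copula is at least `C(u, v)`, and that rectangle has mass `1 - u - v + C(u, v)`. -/
theorem mul_le_integral_self (C : Copula) (u v : I) :
    C u v * (1 - u - v + C u v) ≤ ∫ p, C p.1 p.2 ∂C.measure := by
  rw [← C.measureReal_Ioi_prod_Ioi u v]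
  refine C.mul_measureReal_le_integral C.continuous (fun p => C.nonneg _ _)
    (measurableSet_Ioi.prod measurableSet_Ioi) fun p hp => ?_
  exact (C.mono_left v (le_of_lt hp.1)).trans (C.mono_right _ (le_of_lt hp.2))

/-- The upper bound behind `1 - 8 m²`: the nonnegative function `y - C(x, y)` has integral
`1 / 2 - ∫ C dC`, and it is at least `v - C(u, v)` on the rectangle `[0, u] × (v, 1]`, which has
mass `u - C(u, v)`. -/
theorem integral_self_le (C : Copula) (u v : I) :
    ∫ p, C p.1 p.2 ∂C.measure ≤ 1 / 2 - (v - C u v) * (u - C u v) := by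
  have hc : Continuous fun p : I × I => (p.2 : ℝ) - C p.1 p.2 :=
    (continuous_subtype_val.comp continuous_snd).sub C.continuous
  have h := C.mul_measureReal_le_integral (c := v - C u v) hc
    (fun p => sub_nonneg.2 (C.le_right _ _))
    (measurableSet_Iic.prod measurableSet_Ioi : MeasurableSet (Iic u ×ˢ Ioi v)) fun p hp => by
      have h1 := C.mono_left p.2 (show p.1 ≤ u from hp.1)
      have h2 := C.lip_right u (le_of_lt (show v < p.2 from hp.2))
      linarith
  rw [C.measureReal_Iic_prod_Ioi] at h
  have hsub : ∫ p, ((p.2 : ℝ) - C p.1 p.2) ∂C.measure = _ := integral_sub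
    (integrable_of_continuous (continuous_subtype_val.comp continuous_snd)) (C.integrable _)
  simp only [C.integral_snd] at hsub
  linarith

theorem kendallTau_eq (C : Copula) : C.kendallTau = 4 * ∫ p, C p.1 p.2 ∂C.measure - 1 := rfl

/-- The asymmetry at `(a, b)` is at most each of `min a b`, `|a - b|` and `1 - max a b`, and these
three numbers add up to `1`. -/
theorem three_mul_sub_le_one (C : Copula) (a b : I) : 3 * (C a b - C b a) ≤ 1 := by
  have h1 := C.le_left a b
  have h2 := C.le_right a b
  have h3 := C.nonneg b a
  have h4 := C.add_sub_one_le b a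
  rcases le_total a b with h | h
  · have h5 := C.mono_left b h
    have h6 := C.lip_right b h
    linarith
  · have h5 := C.lip_left b h
    have h6 := C.mono_right b h
    linarith

theorem le_kendallTau (C : Copula) {a b : I} (h : 0 ≤ C a b - C b a) :
    4 * (C a b - C b a) ^ 2 - 1 ≤ C.kendallTau := by
  have h1 := C.mul_le_integral_self a b
  have h2 := C.nonneg b a
  have h3 := C.add_sub_one_le b a
  have h4 : (C a b - C b a) * (C a b - C b a) ≤ C a b * (1 - a - b + C a b) :=
    mul_le_mul (by linarith) (by linarith) h (C.nonneg a b)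
  rw [kendallTau_eq]
  linarith

/-- Apply `integral_self_le` at `(b, a)`. Both `a` and `b` exceed `C(b, a)` by at least the
asymmetry `k = C(a, b) - C(b, a)`, and since also `k ≤ |a - b|`, the larger one exceeds it by at
least `2 k`. -/
theorem kendallTau_le (C : Copula) {a b : I} (h : 0 ≤ C a b - C b a) :
    C.kendallTau ≤ 1 - 8 * (C a b - C b a) ^ 2 := by
  have h1 := C.integral_self_le b a
  have ha := C.le_left a b
  have hb := C.le_right a b
  have key : 2 * (C a b - C b a) ^ 2 ≤ (a - C b a) * (b - C b a) := by
    rcases le_total a b with hab | hab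
    · have h5 := C.mono_left b hab
      have h6 := C.lip_right b hab
      have := mul_le_mul (show C a b - C b a ≤ a - C b a by linarith)
        (show 2 * (C a b - C b a) ≤ b - C b a by linarith) (by linarith) (by linarith)
      linarith
    · have h5 := C.lip_left b hab
      have h6 := C.mono_right b hab
      have := mul_le_mul (show 2 * (C a b - C b a) ≤ a - C b a by linarith)
        (show C a b - C b a ≤ b - C b a by linarith) (by linarith) (by linarith)
      linarith
  rw [kendallTau_eq]
  linarith

/-! ### The measure of asymmetry -/

theorem abs_sub_le_muInf (C : Copula) (u v : I) : |C u v - C v u| ≤ C.muInf := by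
  have hb : BddAbove (range fun p : I × I => |C p.1 p.2 - C.transpose p.1 p.2|) := by
    refine ⟨1, ?_⟩
    rintro _ ⟨p, rfl⟩
    have h1 := C.three_mul_sub_le_one p.1 p.2
    have h2 := C.three_mul_sub_le_one p.2 p.1
    simp only [transpose, abs_le]
    constructor <;> linarith
  exact le_ciSup hb (u, v)

/-- The supremum defining `μ_∞` is attained, and no absolute value is needed: transposing the point
changes the sign of `C(a, b) - C(b, a)`. -/
theorem exists_sub_eq_muInf (C : Copula) : ∃ a b : I, C a b - C b a = C.muInf := by
  obtain ⟨p, -, hp⟩ := isCompact_univ.exists_isMaxOn (univ_nonempty (α := I × I))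
    (f := fun p : I × I => C p.1 p.2 - C p.2 p.1)
    (C.continuous.sub (C.continuous.comp continuous_swap)).continuousOn
  refine ⟨p.1, p.2, le_antisymm ((le_abs_self _).trans (C.abs_sub_le_muInf _ _)) ?_⟩
  refine ciSup_le fun q => ?_
  have h1 := hp (mem_univ q)
  have h2 := hp (mem_univ q.swap)
  simp only [Prod.fst_swap, Prod.snd_swap, mem_ofPred_eq] at h1 h2
  simp only [transpose, abs_le]
  constructor <;> linarith

theorem muInf_nonneg (C : Copula) : 0 ≤ C.muInf :=
  (abs_nonneg _).trans (C.abs_sub_le_muInf 0 0)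

theorem muInf_le_third (C : Copula) : C.muInf ≤ 1 / 3 := by
  obtain ⟨a, b, h⟩ := C.exists_sub_eq_muInf
  have := C.three_mul_sub_le_one a b
  linarith

theorem kendallTau_mem (C : Copula) :
    C.kendallTau ∈ Icc (4 * C.muInf ^ 2 - 1) (1 - 8 * C.muInf ^ 2) := by
  obtain ⟨a, b, h⟩ := C.exists_sub_eq_muInf
  have h0 : 0 ≤ C a b - C b a := h ▸ C.muInf_nonneg
  rw [← h]
  exact ⟨C.le_kendallTau h0, C.kendallTau_le h0⟩

theorem muInf_eq {C : Copula} {m : ℝ} {a b : I} (hab : C a b - C b a = m)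
    (h : ∀ u v, C u v - C v u ≤ m) : C.muInf = m := by
  refine le_antisymm ?_ (hab ▸ (le_abs_self _).trans (C.abs_sub_le_muInf a b))
  obtain ⟨x, y, hxy⟩ := C.exists_sub_eq_muInf
  exact hxy ▸ h x y

theorem isSymmetric_of_muInf_eq_zero {C : Copula} (h : C.muInf = 0) : C.IsSymmetric := by
  refine Copula.ext (funext fun u => funext fun v => ?_)
  have := C.abs_sub_le_muInf v u
  rw [h] at this
  exact sub_eq_zero.1 (abs_nonpos_iff.1 this)

/-! ### Reflection -/

/-- The reflection `C^σ(u, v) = v - C(1 - u, v)`: if `(X, Y)` has distribution `C`, then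
`(1 - X, Y)` has distribution `C^σ`. -/
noncomputable def reflect (C : Copula) : Copula where
  toFun u v := v - C (σ u) v
  zero_left v := by simp [C.one_left]
  zero_right u := by simp [C.zero_right]
  one_left v := by simp [C.zero_left]
  one_right u := by simp [C.one_right]
  two_increasing u₁ u₂ v₁ v₂ hu hv := by
    have := C.two_increasing (σ u₂) (σ u₁) v₁ v₂ (unitInterval.symm_le_symm.2 hu) hv
    linarith

/-- Vertical lines are null for `dC`, because its first margin is Lebesgue measure. -/
theorem measure_Iio_prod_Iic (C : Copula) (u v : I) :
    C.measure (Iio u ×ˢ Iic v) = ENNReal.ofReal (C u v) := by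
  rw [← C.measure_Iic u v, ← Iic_prod_Iic]
  refine measure_congr ?_
  have h : ∀ᵐ p ∂C.measure, p.1 ≠ u := by
    refine ae_of_ae_map measurable_fst.aemeasurable (p := fun x => x ≠ u) ?_
    rw [C.map_fst_measure]
    exact Measure.ae_ne volume u
  filter_upwards [h] with p hp
  exact propext (and_congr_left fun _ => (Ne.le_iff_lt hp).symm)

theorem measure_reflect (C : Copula) :
    C.reflect.measure = C.measure.map (Prod.map σ id) := by
  have hm : Measurable (Prod.map σ id : I × I → I × I) :=
    (unitInterval.continuous_symm.prodMap continuous_id).measurable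
  refine (measure_unique _ _ fun u v => ?_).symm
  have h : (Prod.map σ id : I × I → I × I) ⁻¹' Iic (u, v)
      = Iic ((1 : I), v) \ (Iio (σ u) ×ˢ Iic v) := by
    ext p
    simp only [mem_preimage, mem_Iic, Prod.map, Prod.le_def, id, Set.mem_sdiff, mem_prod, mem_Iio,
      unitInterval.le_one', true_and]
    rw [← not_le (a := σ u), unitInterval.symm_le_comm]
    tauto
  have hsub : Iio (σ u) ×ˢ Iic v ⊆ Iic ((1 : I), v) := fun p hp =>
    Prod.le_def.2 ⟨unitInterval.le_one', hp.2⟩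
  rw [Measure.map_apply hm measurableSet_Iic, h, measure_sdiff hsub
    (measurableSet_Iio.prod measurableSet_Iic).nullMeasurableSet (measure_ne_top _ _),
    measure_Iio_prod_Iic, measure_Iic, C.one_left, ← ENNReal.ofReal_sub _ (C.nonneg _ _)]
  rfl

theorem kendallTau_reflect (C : Copula) : C.reflect.kendallTau = -C.kendallTau := by
  have hm : Measurable (Prod.map σ id : I × I → I × I) :=
    (unitInterval.continuous_symm.prodMap continuous_id).measurable
  rw [kendallTau_eq, kendallTau_eq, measure_reflect, integral_map hm.aemeasurable
    C.reflect.continuous.aestronglyMeasurable]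
  have : ∀ p : I × I, C.reflect (Prod.map σ id p).1 (Prod.map σ id p).2 = p.2 - C p.1 p.2 := by
    intro p
    simp [reflect]
  simp only [this]
  have hsub : ∫ p, ((p.2 : ℝ) - C p.1 p.2) ∂C.measure = _ := integral_sub
    (integrable_of_continuous (continuous_subtype_val.comp continuous_snd)) (C.integrable _)
  rw [hsub, C.integral_snd]
  ring

/-! ### Convex combinations -/

/-- The convex combination `(1 - s) C + s D`. -/
noncomputable def mix (C D : Copula) (s : I) : Copula where
  toFun u v := (1 - s) * C u v + s * D u v
  zero_left v := by simp [zero_left]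
  zero_right u := by simp [zero_right]
  one_left v := by simp only [one_left]; ring
  one_right u := by simp only [one_right]; ring
  two_increasing u₁ u₂ v₁ v₂ hu hv := by
    have h1 := mul_nonneg (unitInterval.one_minus_nonneg s) (C.two_increasing _ _ _ _ hu hv)
    have h2 := mul_nonneg (unitInterval.nonneg s) (D.two_increasing _ _ _ _ hu hv)
    linarith

theorem measure_mix (C D : Copula) (s : I) :
    (C.mix D s).measure = ENNReal.ofReal (1 - s) • C.measure + ENNReal.ofReal s • D.measure := by
  refine (measure_unique _ _ fun u v => ?_).symm
  have h1 := unitInterval.one_minus_nonneg s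
  have h2 := unitInterval.nonneg s
  simp only [Measure.add_apply, Measure.smul_apply, smul_eq_mul, measure_Iic]
  rw [← ENNReal.ofReal_mul h1, ← ENNReal.ofReal_mul h2,
    ← ENNReal.ofReal_add (mul_nonneg h1 (C.nonneg u v)) (mul_nonneg h2 (D.nonneg u v))]
  rfl

theorem concordance_mix (C D E : Copula) (s : I) :
    concordance (C.mix D s) E = (1 - s) * concordance C E + s * concordance D E := by
  simp only [concordance, measure_mix]
  rw [integral_add_measure ((E.integrable _).smul_measure ENNReal.ofReal_ne_top)
    ((E.integrable _).smul_measure ENNReal.ofReal_ne_top), integral_smul_measure,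
    integral_smul_measure, ENNReal.toReal_ofReal (unitInterval.one_minus_nonneg s),
    ENNReal.toReal_ofReal (unitInterval.nonneg s)]
  simp only [smul_eq_mul]
  ring

theorem concordance_mix_right (C D E : Copula) (s : I) :
    concordance E (C.mix D s) = (1 - s) * concordance E C + s * concordance E D := by
  have h : ∫ p, C.mix D s p.1 p.2 ∂E.measure
      = (1 - s) * ∫ p, C p.1 p.2 ∂E.measure + s * ∫ p, D p.1 p.2 ∂E.measure := by
    rw [← integral_const_mul, ← integral_const_mul,
      ← integral_add ((C.integrable _).const_mul _) ((D.integrable _).const_mul _)]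
    rfl
  simp only [concordance, h]
  ring

/-- By bilinearity of the concordance function, `τ` is a quadratic polynomial along a segment. -/
theorem continuous_kendallTau_mix (C D : Copula) : Continuous fun s => (C.mix D s).kendallTau := by
  simp only [kendallTau, concordance_mix, concordance_mix_right]
  fun_prop

theorem exists_mix_kendallTau_eq (C D : Copula) {t : ℝ}
    (h : t ∈ Icc C.kendallTau D.kendallTau) : ∃ s, (C.mix D s).kendallTau = t := by
  have h0 : C.mix D 0 = C := by ext; simp [mix]
  have h1 : C.mix D 1 = D := by ext; simp [mix]
  refine mem_range_of_exists_le_of_exists_ge (C.continuous_kendallTau_mix D) ⟨0, ?_⟩ ⟨1, ?_⟩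
  · rw [h0]; exact h.1
  · rw [h1]; exact h.2

/-! ### Block swaps -/

theorem min_sub_min_sub_min_add_min_nonneg {a a' b b' : ℝ} (ha : a ≤ a') (hb : b ≤ b') :
    0 ≤ min a' b' - min a' b - min a b' + min a b := by
  grind

/-- The distribution function of the segment `{(x, x + c) | l < x ≤ r}` with the mass that
projects to Lebesgue measure on `(l, r]`. The formula is valid for all `u`, `v`: an empty range of
`x` gives `0`. -/
noncomputable def strip (l r c u v : ℝ) : ℝ := max (min r (min u (v - c)) - l) 0

theorem strip_nonneg (l r c u v : ℝ) : 0 ≤ strip l r c u v := le_max_right _ _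

/-- The length of `(l, min r x]`, zero if this interval is empty. -/
noncomputable def clamp (l r x : ℝ) : ℝ := max (min r x - l) 0

theorem clamp_mono (l r : ℝ) : Monotone (clamp l r) := fun _ _ h => by
  unfold clamp
  gcongr

theorem strip_eq_min (l r c u v : ℝ) :
    strip l r c u v = min (clamp l r u) (clamp l r (v - c)) := by
  unfold strip clamp
  grind

theorem strip_two_increasing (l r c : ℝ) {u₁ u₂ v₁ v₂ : ℝ} (hu : u₁ ≤ u₂) (hv : v₁ ≤ v₂) :
    0 ≤ strip l r c u₂ v₂ - strip l r c u₂ v₁ - strip l r c u₁ v₂ + strip l r c u₁ v₁ := by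
  simp only [strip_eq_min]
  exact min_sub_min_sub_min_add_min_nonneg (clamp_mono l r hu) (clamp_mono l r (by gcongr))

/-- The two expressions for the block swap copula: the closed form on the left, and on the right the
sum of the masses on the four segments that support it. -/
theorem min_eq_strip_add {s p q u v : ℝ} (hs : 0 ≤ s) (hp : 0 ≤ p) (hq : 0 ≤ q)
    (h : s + p + q ≤ 1) (hu : u ∈ Icc (0 : ℝ) 1) (hv : v ∈ Icc (0 : ℝ) 1) :
    min (min u v) (s + max (u - s - p) 0 + max (v - s - q) 0)
      = strip 0 s 0 u v + strip s (s + p) q u v + strip (s + p) (s + p + q) (-p) u v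
        + strip (s + p + q) 1 0 u v := by
  obtain ⟨hu0, hu1⟩ := hu
  obtain ⟨hv0, hv1⟩ := hv
  simp only [strip_eq_min]
  -- The values at `u` and at `v` of every clamp, according to the block that contains the point.
  have hA : (u ≤ s ∧ clamp 0 s u = u ∧ clamp s (s + p) u = 0 ∧ clamp (s + p) (s + p + q) u = 0 ∧
      clamp (s + p + q) 1 u = 0 ∧ max (u - s - p) 0 = 0) ∨
      (s ≤ u ∧ u ≤ s + p ∧ clamp 0 s u = s ∧ clamp s (s + p) u = u - s ∧
        clamp (s + p) (s + p + q) u = 0 ∧ clamp (s + p + q) 1 u = 0 ∧ max (u - s - p) 0 = 0) ∨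
      (s + p ≤ u ∧ u ≤ s + p + q ∧ clamp 0 s u = s ∧ clamp s (s + p) u = p ∧
        clamp (s + p) (s + p + q) u = u - s - p ∧ clamp (s + p + q) 1 u = 0 ∧
        max (u - s - p) 0 = u - s - p) ∨
      (s + p + q ≤ u ∧ clamp 0 s u = s ∧ clamp s (s + p) u = p ∧
        clamp (s + p) (s + p + q) u = q ∧ clamp (s + p + q) 1 u = u - s - p - q ∧
        max (u - s - p) 0 = u - s - p) := by
    unfold clamp
    rcases le_total u s with h1 | h1
    · left; grind
    rcases le_total u (s + p) with h2 | h2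
    · right; left; grind
    rcases le_total u (s + p + q) with h3 | h3
    · right; right; left; grind
    · right; right; right; grind
  have hB : (v ≤ s ∧ clamp 0 s (v - 0) = v ∧ clamp s (s + p) (v - q) = 0 ∧
      clamp (s + p) (s + p + q) (v - -p) = 0 ∧
      clamp (s + p + q) 1 (v - 0) = 0 ∧ max (v - s - q) 0 = 0) ∨
      (s ≤ v ∧ v ≤ s + q ∧ clamp 0 s (v - 0) = s ∧ clamp s (s + p) (v - q) = 0 ∧
        clamp (s + p) (s + p + q) (v - -p) = v - s ∧ clamp (s + p + q) 1 (v - 0) = 0 ∧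
        max (v - s - q) 0 = 0) ∨
      (s + q ≤ v ∧ v ≤ s + p + q ∧ clamp 0 s (v - 0) = s ∧ clamp s (s + p) (v - q) = v - s - q ∧
        clamp (s + p) (s + p + q) (v - -p) = q ∧ clamp (s + p + q) 1 (v - 0) = 0 ∧
        max (v - s - q) 0 = v - s - q) ∨
      (s + p + q ≤ v ∧ clamp 0 s (v - 0) = s ∧ clamp s (s + p) (v - q) = p ∧
        clamp (s + p) (s + p + q) (v - -p) = q ∧ clamp (s + p + q) 1 (v - 0) = v - s - p - q ∧
        max (v - s - q) 0 = v - s - q) := by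
    clear hA
    unfold clamp
    rcases le_total v s with h1 | h1
    · left; grind
    rcases le_total v (s + q) with h2 | h2
    · right; left; grind
    rcases le_total v (s + p + q) with h3 | h3
    · right; right; left; grind
    · right; right; right; grind
  rcases hA with ⟨a1, a3, a4, a5, a6, a7⟩ | ⟨a1, a2, a3, a4, a5, a6, a7⟩ |
      ⟨a1, a2, a3, a4, a5, a6, a7⟩ | ⟨a1, a3, a4, a5, a6, a7⟩ <;>
    rcases hB with ⟨b1, b3, b4, b5, b6, b7⟩ | ⟨b1, b2, b3, b4, b5, b6, b7⟩ |
      ⟨b1, b2, b3, b4, b5, b6, b7⟩ | ⟨b1, b3, b4, b5, b6, b7⟩ <;>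
    rw [a3, a4, a5, a6, a7, b3, b4, b5, b6, b7] <;>
    clear a3 a4 a5 a6 a7 b3 b4 b5 b6 b7 <;> grind

/-- The measure with distribution function `strip l r c`, for a segment inside the unit square.
The projections to `[0, 1]` only serve to land in the subtype; on such a segment they do nothing. -/
noncomputable def stripMeasure (l r c : ℝ) : Measure (I × I) :=
  (volume.restrict (Ioc l r)).map
    fun x => (projIcc 0 1 zero_le_one x, projIcc 0 1 zero_le_one (x + c))

theorem measurable_strip (c : ℝ) : Measurable fun x : ℝ =>
    (projIcc 0 1 zero_le_one x, projIcc 0 1 zero_le_one (x + c)) :=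
  (continuous_projIcc.prodMk (continuous_projIcc.comp (by fun_prop))).measurable

instance (l r c : ℝ) : IsFiniteMeasure (stripMeasure l r c) := by
  unfold stripMeasure
  infer_instance

theorem coe_projIcc_of_mem {x : ℝ} (hx : x ∈ Icc (0 : ℝ) 1) :
    (projIcc 0 1 zero_le_one x : ℝ) = x := by
  rw [projIcc_of_mem zero_le_one hx]

theorem stripMeasure_Iic {l r c : ℝ} (hl : 0 ≤ l) (hr : r ≤ 1) (hlc : 0 ≤ l + c) (hrc : r + c ≤ 1)
    (u v : I) : stripMeasure l r c (Iic (u, v)) = ENNReal.ofReal (strip l r c u v) := by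
  have hset : (fun x => (projIcc 0 1 zero_le_one x, projIcc 0 1 zero_le_one (x + c))) ⁻¹' Iic (u, v)
      ∩ Ioc l r = Ioc l (min r (min u (v - c))) := by
    ext x
    simp only [mem_inter_iff, mem_preimage, mem_Iic, mem_Ioc, Prod.mk_le_mk, le_min_iff]
    constructor
    · rintro ⟨⟨h1, h2⟩, h3, h4⟩
      rw [← Subtype.coe_le_coe, coe_projIcc_of_mem ⟨by linarith, by linarith⟩] at h1 h2
      exact ⟨h3, h4, h1, by linarith⟩
    · rintro ⟨h1, h2, h3, h4⟩
      refine ⟨?_, h1, h2⟩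
      rw [← Subtype.coe_le_coe, ← Subtype.coe_le_coe,
        coe_projIcc_of_mem ⟨by linarith, by linarith⟩,
        coe_projIcc_of_mem ⟨by linarith, by linarith⟩]
      exact ⟨h3, by linarith⟩
  rw [stripMeasure, Measure.map_apply (measurable_strip c) measurableSet_Iic,
    Measure.restrict_apply (measurable_strip c measurableSet_Iic), hset, Real.volume_Ioc, strip,
    ENNReal.ofReal_max]
  simp

/-- Integral over a segment of a function that is of the form `x + k` there. -/
theorem integral_stripMeasure {l r c k : ℝ} (h : l ≤ r) {f : I × I → ℝ} (hf : Continuous f)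
    (hfk : ∀ x ∈ Ioc l r,
      f (projIcc 0 1 zero_le_one x, projIcc 0 1 zero_le_one (x + c)) = x + k) :
    ∫ p, f p ∂stripMeasure l r c = (r ^ 2 - l ^ 2) / 2 + (r - l) * k := by
  rw [stripMeasure, integral_map (measurable_strip c).aemeasurable hf.aestronglyMeasurable,
    setIntegral_congr_fun measurableSet_Ioc hfk, ← intervalIntegral.integral_of_le h,
    intervalIntegral.integral_add (by simp) (by simp), integral_id,
    intervalIntegral.integral_const, smul_eq_mul]

/-- The shuffle of `M = min` that exchanges the adjacent blocks `[s, s + p]` and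
`[s + p, s + p + q]`: its mass is carried by the graph of the map that shifts the first block up
by `q`, the second one down by `p`, and fixes all other points. It is the largest copula with
value `s` at `(s + p, s + q)`. -/
noncomputable def blockSwap (s p q : ℝ) (hs : 0 ≤ s) (hp : 0 ≤ p) (hq : 0 ≤ q)
    (h : s + p + q ≤ 1) : Copula where
  toFun u v := min (min u v) (s + max (u - s - p) 0 + max (v - s - q) 0)
  zero_left v := by have := v.2.1; have := v.2.2; simp only [Icc.coe_zero]; grind
  zero_right u := by have := u.2.1; have := u.2.2; simp only [Icc.coe_zero]; grind
  one_left v := by have := v.2.1; have := v.2.2; simp only [Icc.coe_one]; grind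
  one_right u := by have := u.2.1; have := u.2.2; simp only [Icc.coe_one]; grind
  two_increasing u₁ u₂ v₁ v₂ hu hv := by
    simp only [min_eq_strip_add hs hp hq h (Subtype.prop _) (Subtype.prop _)]
    have h1 := strip_two_increasing 0 s 0 hu hv
    have h2 := strip_two_increasing s (s + p) q hu hv
    have h3 := strip_two_increasing (s + p) (s + p + q) (-p) hu hv
    have h4 := strip_two_increasing (s + p + q) 1 0 hu hv
    linarith

theorem measure_blockSwap {s p q : ℝ} (hs : 0 ≤ s) (hp : 0 ≤ p) (hq : 0 ≤ q)
    (h : s + p + q ≤ 1) :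
    (blockSwap s p q hs hp hq h).measure = stripMeasure 0 s 0 + stripMeasure s (s + p) q
      + stripMeasure (s + p) (s + p + q) (-p) + stripMeasure (s + p + q) 1 0 := by
  refine (measure_unique _ _ fun u v => ?_).symm
  simp only [Measure.add_apply]
  rw [stripMeasure_Iic (by linarith) (by linarith) (by linarith) (by linarith),
    stripMeasure_Iic (by linarith) (by linarith) (by linarith) (by linarith),
    stripMeasure_Iic (by linarith) (by linarith) (by linarith) (by linarith),
    stripMeasure_Iic (by linarith) (by linarith) (by linarith) (by linarith)]
  have hn := strip_nonneg
  rw [← ENNReal.ofReal_add (hn ..) (hn ..),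
    ← ENNReal.ofReal_add (add_nonneg (hn ..) (hn ..)) (hn ..),
    ← ENNReal.ofReal_add (add_nonneg (add_nonneg (hn ..) (hn ..)) (hn ..)) (hn ..),
    ← min_eq_strip_add hs hp hq h u.2 v.2]
  rfl

/-- On the graph that carries the mass, `V(x, y)` is `x - p` if `x` is in the second block and `x`
elsewhere, so that `∫ V dV = 1 / 2 - p q`. -/
theorem kendallTau_blockSwap {s p q : ℝ} (hs : 0 ≤ s) (hp : 0 ≤ p) (hq : 0 ≤ q)
    (h : s + p + q ≤ 1) : (blockSwap s p q hs hp hq h).kendallTau = 1 - 4 * (p * q) := by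
  set V := blockSwap s p q hs hp hq h with hV
  have hi := fun l r c => V.integrable (stripMeasure l r c)
  have hval : ∀ x y : ℝ, x ∈ Icc (0 : ℝ) 1 → y ∈ Icc (0 : ℝ) 1 →
      V (projIcc 0 1 zero_le_one x) (projIcc 0 1 zero_le_one y)
        = min (min x y) (s + max (x - s - p) 0 + max (y - s - q) 0) := by
    intro x y hx hy
    rw [hV]
    simp only [blockSwap, coe_projIcc_of_mem hx, coe_projIcc_of_mem hy]
  have i1 : ∫ p, V p.1 p.2 ∂stripMeasure 0 s 0 = _ :=
    integral_stripMeasure (k := 0) hs V.continuous fun x ⟨h1, h2⟩ => by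
      rw [hval _ _ ⟨by linarith, by linarith⟩ ⟨by linarith, by linarith⟩]
      grind
  have i2 : ∫ p, V p.1 p.2 ∂stripMeasure s (s + p) q = _ :=
    integral_stripMeasure (k := 0) (by linarith) V.continuous fun x ⟨h1, h2⟩ => by
      rw [hval _ _ ⟨by linarith, by linarith⟩ ⟨by linarith, by linarith⟩]
      grind
  have i3 : ∫ p, V p.1 p.2 ∂stripMeasure (s + p) (s + p + q) (-p) = _ :=
    integral_stripMeasure (k := -p) (by linarith) V.continuous fun x ⟨h1, h2⟩ => by
      rw [hval _ _ ⟨by linarith, by linarith⟩ ⟨by linarith, by linarith⟩]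
      grind
  have i4 : ∫ p, V p.1 p.2 ∂stripMeasure (s + p + q) 1 0 = _ :=
    integral_stripMeasure (k := 0) h V.continuous fun x ⟨h1, h2⟩ => by
      rw [hval _ _ ⟨by linarith, by linarith⟩ ⟨by linarith, by linarith⟩]
      grind
  rw [kendallTau_eq, hV, measure_blockSwap, ← hV, integral_add_measure
    (((hi ..).add_measure (hi ..)).add_measure (hi ..)) (hi ..), integral_add_measure
    ((hi ..).add_measure (hi ..)) (hi ..), integral_add_measure (hi ..) (hi ..), i1, i2, i3, i4]
  ring

/-! ### Copulas with prescribed asymmetry and Kendall's tau -/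

/-- `D` has the least and `E` the greatest value of `τ` allowed by the asymmetry `m`. Both attain
their asymmetry `m` at the same point `((1 - m) / 2, (1 + m) / 2)` with the same sign, so every
convex combination of them has asymmetry exactly `m`, and `τ` takes all values in between. -/
theorem exists_muInf_eq_kendallTau_eq {m t : ℝ} (hm : m ∈ Icc (0 : ℝ) (1 / 3))
    (ht : t ∈ Icc (4 * m ^ 2 - 1) (1 - 8 * m ^ 2)) :
    ∃ C : Copula, C.muInf = m ∧ C.kendallTau = t := by
  obtain ⟨hm0, hm1⟩ := hm
  -- The block lengths make the bounds of `τ` equalities: `p = q = m` for the reflected copula and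
  -- `p = 2 m`, `q = m` for the other one. The offsets put both asymmetries at the same point.
  let D := (blockSwap ((1 - m) / 2) m m (by linarith) hm0 hm0 (by linarith)).reflect
  let E := blockSwap ((1 - 3 * m) / 2) (2 * m) m (by linarith) (by linarith) hm0 (by linarith)
  have hD : D.kendallTau = 4 * m ^ 2 - 1 := by
    rw [kendallTau_reflect, kendallTau_blockSwap]
    ring
  have hE : E.kendallTau = 1 - 8 * m ^ 2 := by
    rw [kendallTau_blockSwap]
    ring
  rw [← hD, ← hE] at ht
  obtain ⟨s, hs⟩ := exists_mix_kendallTau_eq D E ht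
  refine ⟨D.mix E s, ?_, hs⟩
  let a : I := ⟨(1 - m) / 2, by linarith, by linarith⟩
  let b : I := ⟨(1 + m) / 2, by linarith, by linarith⟩
  have hDab : D a b - D b a = m := by
    simp only [D, a, b, reflect, blockSwap, unitInterval.coe_symm_eq]
    grind
  have hEab : E a b - E b a = m := by
    simp only [E, a, b, blockSwap]
    grind
  -- Both copulas lie within `m` of a symmetric one: `M - m ≤ E ≤ M`, `W ≤ D ≤ W + m`.
  have hDle (u v : I) : D u v - D v u ≤ m := by
    simp only [D, reflect, blockSwap, unitInterval.coe_symm_eq]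
    grind
  have hEle (u v : I) : E u v - E v u ≤ m := by
    simp only [E, blockSwap]
    grind
  have hmix (u v : I) : D.mix E s u v - D.mix E s v u
      = (1 - s) * (D u v - D v u) + s * (E u v - E v u) := by
    simp only [mix]
    ring
  refine muInf_eq (a := a) (b := b) ?_ fun u v => ?_
  · rw [hmix, hDab, hEab]
    ring
  · rw [hmix]
    have h1 := mul_le_mul_of_nonneg_left (hDle u v) (unitInterval.one_minus_nonneg s)
    have h2 := mul_le_mul_of_nonneg_left (hEle u v) (unitInterval.nonneg s)
    linarith

end Copula

theorem theorem6p2 :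
    -- the largest possible asymmetry is `1/3`, and it is attained
    IsGreatest (Set.range Copula.muInf) (1 / 3) ∧
    -- the bounds
    (∀ (C : Copula) (m : ℝ), C.muInf = m →
      C.kendallTau ∈ Set.Icc (4 * m ^ 2 - 1) (1 - 8 * m ^ 2)) ∧
    -- every value between the bounds is attained, for every possible asymmetry
    (∀ m ∈ Set.Icc (0 : ℝ) (1 / 3), ∀ t ∈ Set.Icc (4 * m ^ 2 - 1) (1 - 8 * m ^ 2),
      ∃ C : Copula, C.muInf = m ∧ C.kendallTau = t) ∧
    -- symmetric copulas
    Copula.kendallTau '' {C | C.IsSymmetric} = Set.Icc (-1) 1 ∧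
    -- maximally asymmetric copulas
    Copula.kendallTau '' {C | C.muInf = 1 / 3} = Set.Icc (-(5 / 9)) (1 / 9) := by
  refine ⟨⟨?_, ?_⟩, ?_, ?_, ?_, ?_⟩
  · obtain ⟨C, hC, -⟩ := Copula.exists_muInf_eq_kendallTau_eq (m := 1 / 3) (t := 0)
      (by norm_num) (by norm_num)
    exact ⟨C, hC⟩
  · rintro _ ⟨C, rfl⟩
    exact C.muInf_le_third
  · rintro C _ rfl
    exact C.kendallTau_mem
  · exact fun m hm t ht => Copula.exists_muInf_eq_kendallTau_eq hm ht
  · ext t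
    constructor
    · rintro ⟨C, -, rfl⟩
      have h := C.kendallTau_mem
      have h0 := sq_nonneg C.muInf
      exact ⟨by linarith [h.1], by linarith [h.2]⟩
    · intro ht
      obtain ⟨C, hC, rfl⟩ := Copula.exists_muInf_eq_kendallTau_eq (m := 0) (t := t)
        (by norm_num) (by norm_num; exact ht)
      exact ⟨C, Copula.isSymmetric_of_muInf_eq_zero hC, rfl⟩
  · have hI : Icc (4 * (1 / 3 : ℝ) ^ 2 - 1) (1 - 8 * (1 / 3) ^ 2) = Icc (-(5 / 9)) (1 / 9) := by
      norm_num
    rw [← hI]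
    ext t
    constructor
    · rintro ⟨C, hC, rfl⟩
      have h := C.kendallTau_mem
      rwa [show C.muInf = 1 / 3 from hC] at h
    · intro ht
      obtain ⟨C, hC, rfl⟩ := Copula.exists_muInf_eq_kendallTau_eq (m := 1 / 3) (by norm_num) ht
      exact ⟨C, hC, rfl⟩
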